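/- Let $m\ge 1$ and $N\ge 1$ be integers and let $\rho_2,\dots,\rho_N\in(-1,1)$. Let $x_{n,k},y_{n,k}$ ($1\le n\le N$, $1\le k\le m$) be independent real Gaussian random variables with mean $0$ and variance $1/2$, and put $$\hat g_{1,k}=x_{1,k}+\jmath y_{1,k},\qquad \hat g_{n,k}=\sqrt{1-\rho_n^2}\,x_{n,k}+\rho_n x_{1,k}+\jmath\big(\sqrt{1-\rho_n^2}\,y_{n,k}+\rho_n y_{1,k}\big)\quad(2\le n\le N),$$ $\hat h_n=\sum_{k=1}^m|\hat g_{n,k}|^2$. Let $E_n=\{\hat h_n>\hat h_k\text{ for all }k\ne n\}$ be the event that port $n$ is selected. Let $I_{m-1}$ be the modified Bessel function of the first kind, $Q_m(a,b)=\int_b^\infty t\,(t/a)^{m-1}e^{-(t^2+a^2)/2}I_{m-1}(at)\,dt$ the Marcum $Q$-function (with $Q_m(0,b)=\Gamma(m,b^2/2)/\Gamma(m)$), and $$\phi_n(z,x)=1-Q_m\left(\sqrt{\frac{2z\rho_n^2}{1-\rho_n^2}},\sqrt{\frac{2x}{1-\rho_n^2}}\right).$$ For $x>0$ let $$f_1(x)=\frac{1}{\Gamma(m)}e^{-x}x^{m-1}\prod_{k=2}^N\phi_k(x,x),$$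 and, for $n=2,\dots,N$, $$f_n(x)=\frac{1}{\Gamma(m)(1-\rho_n^2)}\int_0^x \exp\left(-\frac{x+z}{1-\rho_n^2}\right)\left(\frac{xz}{\rho_n^2}\right)^{\frac{m-1}{2}} I_{m-1}\left(\frac{2\sqrt{xz\rho_n^2}}{1-\rho_n^2}\right)\prod_{\substack{k=2\\k\ne n}}^N\phi_k(z,x)\,dz,$$ where for $\rho_n=0$ the product $(xz/\rho_n^2)^{(m-1)/2}I_{m-1}(\cdot)$ is read as its limit $(xz)^{m-1}/\Gamma(m)$; let $f_n(x)=0$ for $x\le 0$. Then, for every $n=1,\dots,N$, the integral defining $f_n$ (if $n\ge2$) converges for every $x>0$, the function $f_n$ is nonnegative and integrable, and it is the density of $\hat h_n$ on the event $E_n$: $\mathbb P(\hat h_n\in A,\ E_n)=\int_A f_n(x)\,dx$ for every Borel set $A\subseteq\mathbb R$. In particular $p_n:=\mathbb P(E_n)=\int_0^\infty f_n(x)\,dx$; moreover $p_n>0$, and the conditional distribution of $\hat h_n$ given $E_n$ has the density $f_n/p_n$. -/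

import Mathlib

open MeasureTheory ProbabilityTheory

open scoped ENNReal NNReal

namespace FluidAntenna

noncomputable section

/-- Modified Bessel function of the first kind, of integer order `ν ≥ 0`. -/
def besselI (ν : ℕ) (t : ℝ) : ℝ :=
  ∑' j : ℕ, (t / 2) ^ (2 * j + ν) / ((j.factorial : ℝ) * ((j + ν).factorial : ℝ))

/-- Upper incomplete gamma function `Γ(m, b)` for an integer `m ≥ 1`. -/
def upperGamma (m : ℕ) (b : ℝ) : ℝ :=
  ∫ t in Set.Ioi b, t ^ (m - 1) * Real.exp (-t)

/-- Marcum `Q`-function `Q_m(a, b)` of integer order `m ≥ 1`, for `a, b ≥ 0`. The defining integral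
has a removable singularity at `a = 0`, where the value is `Γ(m, b² / 2) / Γ(m)`. -/
def marcumQ (m : ℕ) (a b : ℝ) : ℝ :=
  if a = 0 then upperGamma m (b ^ 2 / 2) / Real.Gamma m
  else ∫ t in Set.Ioi b,
    t * (t / a) ^ (m - 1) * Real.exp (-(t ^ 2 + a ^ 2) / 2) * besselI (m - 1) (a * t)

/-- `φ(z, x) = 1 - Q_m(√(2zr²/(1-r²)), √(2x/(1-r²)))` for a port with correlation `r`. -/
def phi (m : ℕ) (r z x : ℝ) : ℝ :=
  1 - marcumQ m (Real.sqrt (2 * z * r ^ 2 / (1 - r ^ 2))) (Real.sqrt (2 * x / (1 - r ^ 2)))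

/-- The factor `(xz/r²)^((m-1)/2) I_{m-1}(2√(xzr²)/(1-r²))`; it has a removable singularity at
`r = 0`, where the value is its limit `(xz)^(m-1)/Γ(m)`. -/
def besselFactor (m : ℕ) (r z x : ℝ) : ℝ :=
  if r = 0 then (x * z) ^ (m - 1) / Real.Gamma m
  else (x * z / r ^ 2) ^ (((m : ℝ) - 1) / 2) *
    besselI (m - 1) (2 * Real.sqrt (x * z * r ^ 2) / (1 - r ^ 2))

variable {Ω : Type*} {N : ℕ} [NeZero N] {m : ℕ}

/-- The complex gain `g_{n,k}` at port `n`; the reference (first) port is `0 : Fin N`. -/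
def gain (ρ : Fin N → ℝ) (x y : Fin N → Fin m → Ω → ℝ) (n : Fin N) (k : Fin m) (ω : Ω) : ℂ :=
  if n = 0 then (x 0 k ω : ℂ) + Complex.I * (y 0 k ω : ℂ)
  else ((Real.sqrt (1 - ρ n ^ 2) * x n k ω + ρ n * x 0 k ω : ℝ) : ℂ) +
    Complex.I * ((Real.sqrt (1 - ρ n ^ 2) * y n k ω + ρ n * y 0 k ω : ℝ) : ℂ)

/-- The channel `h_n = ∑_k |g_{n,k}|²`. -/
def channel (ρ : Fin N → ℝ) (x y : Fin N → Fin m → Ω → ℝ) (n : Fin N) (ω : Ω) : ℝ :=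
  ∑ k : Fin m, ‖gain ρ x y n k ω‖ ^ 2

/-- The event that port `n` is selected, i.e. that its channel is the strongest one. -/
def selected (ρ : Fin N → ℝ) (x y : Fin N → Fin m → Ω → ℝ) (n : Fin N) : Set Ω :=
  {ω | ∀ k : Fin N, k ≠ n → channel ρ x y k ω < channel ρ x y n ω}

/-- The expression for the reference port. -/
def densityFirst (m : ℕ) (ρ : Fin N → ℝ) (x : ℝ) : ℝ :=
  1 / Real.Gamma m * Real.exp (-x) * x ^ (m - 1) *
    ∏ k ∈ Finset.univ.filter (fun k : Fin N => k ≠ 0), phi m (ρ k) x x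

/-- The integrand (in `z`) of the expression for a port `n ≠ 0`. -/
def integrandOther (m : ℕ) (ρ : Fin N → ℝ) (n : Fin N) (x z : ℝ) : ℝ :=
  Real.exp (-((x + z) / (1 - ρ n ^ 2))) * besselFactor m (ρ n) z x *
    ∏ k ∈ Finset.univ.filter (fun k : Fin N => k ≠ 0 ∧ k ≠ n), phi m (ρ k) z x

/-- The expression for a port `n ≠ 0`. -/
def densityOther (m : ℕ) (ρ : Fin N → ℝ) (n : Fin N) (x : ℝ) : ℝ :=
  1 / (Real.Gamma m * (1 - ρ n ^ 2)) * ∫ z in (0 : ℝ)..x, integrandOther m ρ n x z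

/-- The density of the channel at port `n` on the event that port `n` is selected; it vanishes off
the positive half-line. -/
def density (m : ℕ) (ρ : Fin N → ℝ) (n : Fin N) (x : ℝ) : ℝ :=
  if x ≤ 0 then 0 else if n = 0 then densityFirst m ρ x else densityOther m ρ n x

end

end FluidAntenna

open FluidAntenna

namespace FluidAntenna

/-! Write `m = ν + 1` and collect the real coordinates of port `n` in a Gaussian vector `w n` of
length `2 (ν + 1)`. Freeze the reference vector at `u` and put `z = ∑ i, u i ^ 2`. The other
channels become independent, and channel `n` is `1 - ρ n ^ 2` times the squared distance of a
Gaussian vector from a fixed point. Comparing moment-generating functions shows that this squared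
distance is noncentral chi-squared (`map_sum_sq_gaussian`), so it depends on `u` only through `z`;
the functions `φ` are the distribution functions of these laws (`phi_eq`).

Given `z`, the channels thus have the product law `Measure.pi (conditionalLaw ν ρ z)`, with a Dirac
mass at the reference port (`map_channelOfVectors_update`). For a product law, the probability that
coordinate `n` lies in `A` and beats the rest is an integral of a product of distribution functions
(`pi_isMax_apply`). Averaging over `z`, which is Gamma distributed, gives the first formula
directly. For the other ports the Dirac factor becomes the constraint `z < x`, and Tonelli's theorem
gives the integral over `(0, x)` (`measure_selected_channelOfVectors`). The Bessel form of the
integrand is then algebra (`noncentralPDF_mul_eq`). Integrability and the selection probability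
follow by taking `A = univ`. -/

open Set Filter Topology

/-! ### Uniqueness of a law from its moment-generating function near zero. -/

/-- Two finite measures on `ℝ` whose moment-generating functions are finite and agree near `0`
are equal. -/
theorem measure_ext_of_mgf_eventuallyEq {μ μ' : Measure ℝ} [IsFiniteMeasure μ] [IsFiniteMeasure μ']
    (hμ : 0 ∈ interior (integrableExpSet id μ)) (hμ' : 0 ∈ interior (integrableExpSet id μ'))
    (h : ∀ᶠ t in 𝓝 (0 : ℝ), mgf id μ t = mgf id μ' t) : μ = μ' := by
  have hX : AnalyticOnNhd ℂ (complexMGF id μ) {z | z.re ∈ interior (integrableExpSet id μ)} :=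
    analyticOnNhd_complexMGF
  have hY : AnalyticOnNhd ℂ (complexMGF id μ') {z | z.re ∈ interior (integrableExpSet id μ')} :=
    analyticOnNhd_complexMGF
  -- Both complex transforms are analytic on a vertical strip, connected because it is convex.
  -- Agreement on real points near `0` spreads to the strip, whose imaginary axis carries the
  -- characteristic functions.
  have key : EqOn (complexMGF id μ) (complexMGF id μ')
      {z | z.re ∈ interior (integrableExpSet id μ) ∩ interior (integrableExpSet id μ')} := by
    refine AnalyticOnNhd.eqOn_of_preconnected_of_frequently_eq
      (hX.mono fun z hz => hz.1) (hY.mono fun z hz => hz.2)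
      ((convex_integrableExpSet.interior.inter
        convex_integrableExpSet.interior).linear_preimage Complex.reLm).isPreconnected
      (z₀ := ((0 : ℝ) : ℂ)) (by simp [hμ, hμ']) ?_
    have h_real : ∃ᶠ (x : ℝ) in 𝓝[≠] 0, complexMGF id μ x = complexMGF id μ' x := by
      refine (Filter.Eventually.filter_mono nhdsWithin_le_nhds ?_).frequently
      filter_upwards [h] with t ht
      rw [complexMGF_ofReal, complexMGF_ofReal, ht]
    rw [frequently_iff_seq_forall] at h_real ⊢
    obtain ⟨xs, hx_tendsto, hx_eq⟩ := h_real
    refine ⟨fun n ↦ xs n, ?_, fun n ↦ hx_eq n⟩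
    rw [tendsto_nhdsWithin_iff] at hx_tendsto ⊢
    refine ⟨(Complex.continuous_ofReal.tendsto 0).comp hx_tendsto.1, ?_⟩
    simpa using hx_tendsto.2
  refine Measure.ext_of_charFun ?_
  funext t
  have := key (x := (t : ℂ) * Complex.I) (by simp [hμ, hμ'])
  rwa [complexMGF_id_mul_I, complexMGF_id_mul_I] at this

/-! ### The noncentral chi-squared law as the law of a squared Gaussian distance. -/

noncomputable section

/-- The entire function `∑ w ^ j / (j! (j + ν)!)`, with 
`besselI ν t = (t / 2) ^ ν * besselSeries ν (t ^ 2 / 4)`. -/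
def besselSeries (ν : ℕ) (w : ℝ) : ℝ :=
  ∑' j : ℕ, w ^ j / ((j.factorial : ℝ) * ((j + ν).factorial : ℝ))

theorem summable_besselSeries (ν : ℕ) (w : ℝ) :
    Summable fun j : ℕ => w ^ j / ((j.factorial : ℝ) * ((j + ν).factorial : ℝ)) := by
  refine Summable.of_norm_bounded (Real.summable_pow_div_factorial |w|) fun j => ?_
  rw [norm_div, norm_pow, Real.norm_eq_abs, Real.norm_of_nonneg (by positivity)]
  have h1 : (1 : ℝ) ≤ ((j + ν).factorial : ℝ) := by
    exact_mod_cast Nat.one_le_iff_ne_zero.mpr (Nat.factorial_ne_zero _)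
  have h2 : (0 : ℝ) < (j.factorial : ℝ) := by positivity
  gcongr
  nlinarith

theorem besselI_eq (ν : ℕ) (t : ℝ) :
    besselI ν t = (t / 2) ^ ν * besselSeries ν (t ^ 2 / 4) := by
  rw [besselI, besselSeries, ← tsum_mul_left]
  refine tsum_congr fun j => ?_
  rw [pow_add, pow_mul, div_pow t 2 2]
  norm_num
  ring

theorem besselSeries_zero (ν : ℕ) : besselSeries ν 0 = 1 / (ν.factorial : ℝ) := by
  rw [besselSeries, tsum_eq_single 0 (by intro j hj; simp [hj])]
  simp

theorem besselSeries_pos {ν : ℕ} {w : ℝ} (hw : 0 ≤ w) : 0 < besselSeries ν w :=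
  (summable_besselSeries ν w).tsum_pos (fun j => by positivity) 0 (by simp; positivity)

theorem exp_eq_tsum_pow_div_factorial (w : ℝ) :
    Real.exp w = ∑' j : ℕ, w ^ j / (j.factorial : ℝ) := by
  rw [Real.exp_eq_exp_ℝ, NormedSpace.exp_eq_tsum_div]

theorem besselSeries_le_exp {ν : ℕ} {w : ℝ} (hw : 0 ≤ w) : besselSeries ν w ≤ Real.exp w := by
  rw [exp_eq_tsum_pow_div_factorial]
  refine (summable_besselSeries ν w).tsum_le_tsum (fun j => ?_) (Real.summable_pow_div_factorial w)
  have h1 : (1 : ℝ) ≤ ((j + ν).factorial : ℝ) := by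
    exact_mod_cast Nat.one_le_iff_ne_zero.mpr (Nat.factorial_ne_zero _)
  have h2 : (0 : ℝ) < (j.factorial : ℝ) := by positivity
  gcongr
  nlinarith

@[fun_prop]
theorem measurable_besselSeries (ν : ℕ) : Measurable (besselSeries ν) := by
  refine measurable_of_tendsto_metrizable
    (f := fun n w => ∑ j ∈ Finset.range n, w ^ j / ((j.factorial : ℝ) * ((j + ν).factorial : ℝ)))
    (fun n => by fun_prop) ?_
  rw [tendsto_pi_nhds]
  exact fun w => (summable_besselSeries ν w).hasSum.tendsto_sum_nat

/-- The density at `v > 0` of half a noncentral chi-squared variable with `2 (ν + 1)` degrees of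
freedom and noncentrality `2 l`. -/
def noncentralPDF (ν : ℕ) (l v : ℝ) : ℝ :=
  v ^ ν * Real.exp (-(v + l)) * besselSeries ν (l * v)

theorem noncentralPDF_pos {ν : ℕ} {l v : ℝ} (hl : 0 ≤ l) (hv : 0 < v) :
    0 < noncentralPDF ν l v := by
  have := besselSeries_pos (ν := ν) (mul_nonneg hl hv.le)
  unfold noncentralPDF; positivity

theorem noncentralPDF_zero (ν : ℕ) (v : ℝ) :
    noncentralPDF ν 0 v = v ^ ν * Real.exp (-v) / (ν.factorial : ℝ) := by
  simp [noncentralPDF, besselSeries_zero]; ring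

theorem measurable_noncentralPDF (ν : ℕ) :
    Measurable fun p : ℝ × ℝ => noncentralPDF ν p.1 p.2 := by
  unfold noncentralPDF; fun_prop

/-- The law with density `noncentralPDF ν l` on the positive half-line. -/
def noncentralLaw (ν : ℕ) (l : ℝ) : Measure ℝ :=
  (volume.restrict (Ioi 0)).withDensity fun v => ENNReal.ofReal (noncentralPDF ν l v)

theorem lintegral_pow_mul_exp_neg (k : ℕ) {c : ℝ} (hc : 0 < c) :
    ∫⁻ v in Ioi (0 : ℝ), ENNReal.ofReal (v ^ k * Real.exp (-(c * v))) =
      ENNReal.ofReal (k.factorial / c ^ (k + 1)) := by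
  have hval := Real.integral_rpow_mul_exp_neg_mul_Ioi (a := k + 1) (by positivity) hc
  simp only [add_sub_cancel_right, Real.rpow_natCast, Real.Gamma_nat_eq_factorial] at hval
  rw [show ((k : ℝ) + 1) = ((k + 1 : ℕ) : ℝ) by push_cast; ring, Real.rpow_natCast] at hval
  -- A nonzero Bochner integral certifies integrability, since the integral of a non-integrable
  -- function is `0` by convention.
  have hpos : ∫ t in Ioi (0 : ℝ), t ^ k * Real.exp (-(c * t)) ≠ 0 := by
    rw [hval]; positivity
  rw [← ofReal_integral_eq_lintegral_ofReal
    (not_not.mp fun h => hpos (integral_undef h)), hval]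
  · congr 1; rw [one_div, inv_pow]; field_simp
  · filter_upwards [ae_restrict_mem measurableSet_Ioi] with v hv
    have : (0 : ℝ) < v := hv
    positivity

/-- Integrate the Bessel series term by term, which is free for nonnegative terms. Each Gamma
integral yields `(j + ν)!`, cancelling that factor of the coefficient, and what remains is the
exponential series at `l / (1 - t)`. -/
theorem lintegral_exp_mul_noncentralPDF (ν : ℕ) {l t : ℝ} (hl : 0 ≤ l) (ht : t < 1) :
    ∫⁻ v in Ioi (0 : ℝ), ENNReal.ofReal (Real.exp (t * v) * noncentralPDF ν l v) =
      ENNReal.ofReal ((1 / (1 - t)) ^ (ν + 1) * Real.exp (t * l / (1 - t))) := by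
  have h1t : 0 < 1 - t := by linarith
  have hterm : ∀ v ∈ Ioi (0 : ℝ), ENNReal.ofReal (Real.exp (t * v) * noncentralPDF ν l v) =
      ∑' j : ℕ, ENNReal.ofReal
        (Real.exp (-l) * l ^ j / ((j.factorial : ℝ) * ((j + ν).factorial : ℝ))) *
        ENNReal.ofReal (v ^ (j + ν) * Real.exp (-((1 - t) * v))) := by
    intro v hv
    have hv' : (0 : ℝ) < v := hv
    simp_rw [← ENNReal.ofReal_mul (show 0 ≤ Real.exp (-l) * l ^ _ /
      (((_ : ℕ).factorial : ℝ) * ((_ + ν).factorial : ℝ)) by positivity)]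
    have hs := (summable_besselSeries ν (l * v)).mul_left
      (Real.exp (t * v) * (v ^ ν * Real.exp (-(v + l))))
    have he : Real.exp (t * v) * Real.exp (-(v + l)) = Real.exp (-l) * Real.exp (-((1 - t) * v)) := by
      rw [← Real.exp_add, ← Real.exp_add]; congr 1; ring
    have hfun : (fun j : ℕ => Real.exp (t * v) * (v ^ ν * Real.exp (-(v + l))) *
        ((l * v) ^ j / ((j.factorial : ℝ) * ((j + ν).factorial : ℝ)))) = fun j : ℕ =>
        Real.exp (-l) * l ^ j / ((j.factorial : ℝ) * ((j + ν).factorial : ℝ)) *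
          (v ^ (j + ν) * Real.exp (-((1 - t) * v))) := by
      funext j
      rw [show Real.exp (t * v) * (v ^ ν * Real.exp (-(v + l))) =
        v ^ ν * (Real.exp (t * v) * Real.exp (-(v + l))) by ring, he, mul_pow, pow_add]
      ring
    rw [hfun] at hs
    rw [← ENNReal.ofReal_tsum_of_nonneg (fun j => by positivity) hs, ← hfun, tsum_mul_left,
      noncentralPDF, besselSeries]
    ring_nf
  rw [setLIntegral_congr_fun measurableSet_Ioi hterm, lintegral_tsum (fun j => by fun_prop)]
  simp_rw [lintegral_const_mul' _ _ ENNReal.ofReal_ne_top, lintegral_pow_mul_exp_neg _ h1t]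
  simp_rw [← ENNReal.ofReal_mul (show 0 ≤ Real.exp (-l) * l ^ _ /
      (((_ : ℕ).factorial : ℝ) * ((_ + ν).factorial : ℝ)) by positivity)]
  have hfun : (fun j : ℕ => Real.exp (-l) * l ^ j / ((j.factorial : ℝ) * ((j + ν).factorial : ℝ)) *
      ((j + ν).factorial / (1 - t) ^ (j + ν + 1))) = fun j : ℕ =>
      ((1 / (1 - t)) ^ (ν + 1) * Real.exp (-l)) * ((l / (1 - t)) ^ j / (j.factorial : ℝ)) := by
    funext j
    rw [add_assoc, pow_add (1 - t) j, one_div, inv_pow, div_pow]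
    field_simp
  have hs := (Real.summable_pow_div_factorial (l / (1 - t))).mul_left
    ((1 / (1 - t)) ^ (ν + 1) * Real.exp (-l))
  rw [← hfun] at hs
  rw [← ENNReal.ofReal_tsum_of_nonneg (fun j => by positivity) hs, hfun, tsum_mul_left,
    ← exp_eq_tsum_pow_div_factorial, mul_assoc, ← Real.exp_add]
  congr 3
  field_simp
  ring

theorem isProbabilityMeasure_noncentralLaw (ν : ℕ) {l : ℝ} (hl : 0 ≤ l) :
    IsProbabilityMeasure (noncentralLaw ν l) := by
  constructor
  have := lintegral_exp_mul_noncentralPDF ν hl (t := 0) one_pos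
  simp at this
  rw [noncentralLaw, withDensity_apply _ MeasurableSet.univ, Measure.restrict_univ, this]

theorem hasMGF_noncentralLaw (ν : ℕ) {l t : ℝ} (hl : 0 ≤ l) (ht : t < 1) :
    Integrable (fun v => Real.exp (t * v)) (noncentralLaw ν l) ∧
    mgf id (noncentralLaw ν l) t =
      (1 / (1 - t)) ^ (ν + 1) * Real.exp (t * l / (1 - t)) := by
  have h1t : 0 < 1 - t := by linarith
  have hlin : ∫⁻ v, ENNReal.ofReal (Real.exp (t * v)) ∂(noncentralLaw ν l) =
      ENNReal.ofReal ((1 / (1 - t)) ^ (ν + 1) * Real.exp (t * l / (1 - t))) := by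
    rw [noncentralLaw, lintegral_withDensity_eq_lintegral_mul _ (by
      have := (measurable_noncentralPDF ν).comp (measurable_prodMk_left (x := l))
      exact this.ennreal_ofReal) (by fun_prop), ← lintegral_exp_mul_noncentralPDF ν hl ht]
    refine lintegral_congr fun v => ?_
    rw [Pi.mul_apply, mul_comm, ENNReal.ofReal_mul (Real.exp_pos _).le]
  have hint : Integrable (fun v => Real.exp (t * v)) (noncentralLaw ν l) := by
    rw [← lintegral_ofReal_ne_top_iff_integrable (by fun_prop)
      (ae_of_all _ fun v => (Real.exp_pos _).le), hlin]
    exact ENNReal.ofReal_ne_top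
  refine ⟨hint, ?_⟩
  rw [mgf]
  simp only [id]
  rw [integral_eq_lintegral_of_nonneg_ae (ae_of_all _ fun v => (Real.exp_pos _).le)
    hint.aestronglyMeasurable, hlin, ENNReal.toReal_ofReal (by positivity)]

/-- Completing the square: the density tilted by `exp (t (v + a) ^ 2)` is a multiple of the Gaussian
density with mean `t a / (1 - t)` and variance `1 / (2 (1 - t))`. -/
theorem hasMGF_sq_gaussian (a : ℝ) {t : ℝ} (ht : t < 1) :
    Integrable (fun v => Real.exp (t * (v + a) ^ 2)) (gaussianReal 0 (1 / 2)) ∧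
    mgf (fun v => (v + a) ^ 2) (gaussianReal 0 (1 / 2)) t =
      Real.sqrt (1 / (1 - t)) * Real.exp (t * a ^ 2 / (1 - t)) := by
  have h1t : 0 < 1 - t := by linarith
  obtain ⟨s, hs⟩ : ∃ s : ℝ≥0, (s : ℝ) = 1 / (2 * (1 - t)) :=
    ⟨Real.toNNReal (1 / (2 * (1 - t))), Real.coe_toNNReal _ (by positivity)⟩
  have hs0 : s ≠ 0 := by
    rw [← NNReal.coe_ne_zero, hs]; positivity
  have hv : (1 / 2 : ℝ≥0) ≠ 0 := by norm_num
  have hpt : ∀ v, gaussianPDFReal 0 (1 / 2) v * Real.exp (t * (v + a) ^ 2) =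
      Real.sqrt (1 / (1 - t)) * Real.exp (t * a ^ 2 / (1 - t)) *
        gaussianPDFReal (t * a / (1 - t)) s v := by
    intro v
    simp only [gaussianPDFReal, hs]
    have e1 : (Real.sqrt (2 * Real.pi * ((1 / 2 : ℝ≥0) : ℝ)))⁻¹ =
        Real.sqrt (1 / (1 - t)) * (Real.sqrt (2 * Real.pi * (1 / (2 * (1 - t)))))⁻¹ := by
      rw [← Real.sqrt_inv, ← Real.sqrt_inv, ← Real.sqrt_mul (by positivity)]
      congr 1
      push_cast
      field_simp
    rw [e1, mul_assoc, ← Real.exp_add, mul_mul_mul_comm, ← Real.exp_add]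
    congr 2
    push_cast
    field_simp
    ring
  constructor
  · rw [gaussianReal_of_var_ne_zero _ hv, integrable_withDensity_iff_integrable_smul'
      (measurable_gaussianPDF _ _) (ae_of_all _ fun _ => gaussianPDF_lt_top)]
    simp only [toReal_gaussianPDF, smul_eq_mul]
    simp_rw [hpt]
    exact (integrable_gaussianPDFReal _ _).const_mul _
  · rw [mgf, integral_gaussianReal_eq_integral_smul hv]
    simp only [smul_eq_mul]
    simp_rw [hpt]
    rw [integral_const_mul, integral_gaussianPDFReal_eq_one _ hs0, mul_one]

/-- The law of the squared distance of a standard Gaussian vector (variance `1/2` per coordinate)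
from a fixed point is noncentral chi-squared. -/
theorem map_sum_sq_gaussian {ι : Type*} [Fintype ι] {ν : ℕ} (hι : Fintype.card ι = 2 * (ν + 1))
    (a : ι → ℝ) :
    (Measure.pi fun _ : ι => gaussianReal 0 (1 / 2)).map (fun w => ∑ i, (w i + a i) ^ 2) =
      noncentralLaw ν (∑ i, a i ^ 2) := by
  set γ := Measure.pi fun _ : ι => gaussianReal 0 (1 / 2)
  have hl : 0 ≤ ∑ i, a i ^ 2 := Finset.sum_nonneg fun i _ => sq_nonneg _
  have := isProbabilityMeasure_noncentralLaw ν hl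
  have hX : ∀ i : ι, Measurable fun w : ι → ℝ => (w i + a i) ^ 2 := fun i => by fun_prop
  have hmeas : Measurable fun w : ι → ℝ => ∑ i, (w i + a i) ^ 2 := by fun_prop
  have hind : iIndepFun (fun i (w : ι → ℝ) => (w i + a i) ^ 2) γ :=
    iIndepFun_pi (X := fun i (v : ℝ) => (v + a i) ^ 2) fun i => by fun_prop
  have hsum : (∑ i, fun w : ι → ℝ => (w i + a i) ^ 2) = fun w => ∑ i, (w i + a i) ^ 2 := by
    funext w; simp
  have hone : ∀ t < 1, ∀ i, Integrable (fun w : ι → ℝ => Real.exp (t * (w i + a i) ^ 2)) γ ∧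
      mgf (fun w : ι → ℝ => (w i + a i) ^ 2) γ t =
        Real.sqrt (1 / (1 - t)) * Real.exp (t * a i ^ 2 / (1 - t)) := by
    intro t ht i
    have hp := measurePreserving_eval (fun _ : ι => gaussianReal 0 (1 / 2)) i
    obtain ⟨h1, h2⟩ := hasMGF_sq_gaussian (a i) ht
    refine ⟨hp.integrable_comp_of_integrable h1, ?_⟩
    rw [← h2, mgf, mgf, ← hp.map_eq, integral_map hp.aemeasurable (by fun_prop)]
  have hsumone : ∀ t < 1, t ∈ integrableExpSet id (γ.map fun w => ∑ i, (w i + a i) ^ 2) ∧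
      mgf id (γ.map fun w => ∑ i, (w i + a i) ^ 2) t =
        (1 / (1 - t)) ^ (ν + 1) * Real.exp (t * (∑ i, a i ^ 2) / (1 - t)) := by
    intro t ht
    have h1t : 0 < 1 - t := by linarith
    constructor
    · have h := hind.integrable_exp_mul_sum (t := t) hX (s := Finset.univ)
        fun i _ => (hone t ht i).1
      rw [hsum] at h
      rw [integrableExpSet, mem_ofPred_eq, integrable_map_measure (by fun_prop) hmeas.aemeasurable]
      exact h
    -- The `2 (ν + 1)` square-root factors pair up into the power `ν + 1`.
    · have h := hind.mgf_sum (t := t) hX Finset.univ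
      rw [hsum] at h
      rw [mgf_id_map hmeas.aemeasurable, h, Finset.prod_congr rfl fun i _ => (hone t ht i).2,
        Finset.prod_mul_distrib, Finset.prod_const, Finset.card_univ, hι, pow_mul,
        Real.sq_sqrt (by positivity), ← Real.exp_sum, Finset.mul_sum, Finset.sum_div]
  have hnhds : Iio (1 : ℝ) ∈ 𝓝 0 := Iio_mem_nhds one_pos
  have := Measure.isProbabilityMeasure_map (μ := γ) hmeas.aemeasurable
  refine measure_ext_of_mgf_eventuallyEq ?_ ?_ ?_
  · exact mem_interior_iff_mem_nhds.mpr (mem_of_superset hnhds fun t ht => (hsumone t ht).1)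
  · exact mem_interior_iff_mem_nhds.mpr
      (mem_of_superset hnhds fun t ht => (hasMGF_noncentralLaw ν hl ht).1)
  · filter_upwards [hnhds] with t ht
    rw [(hsumone t ht).2, (hasMGF_noncentralLaw ν hl ht).2]

end

/-! ### Bessel factor, Marcum function and `φ` in terms of the noncentral law. -/

/-- The power of `r` in the denominator cancels the leading power of the Bessel function. The
resulting expression is also valid at `r = 0`, so this removable singularity needs no further case
split. -/
theorem besselFactor_eq (ν : ℕ) {r z x : ℝ} (hr : r ^ 2 < 1) (hxz : 0 ≤ x * z) :
    besselFactor (ν + 1) r z x =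
      (x * z / (1 - r ^ 2)) ^ ν * besselSeries ν (x * z * r ^ 2 / (1 - r ^ 2) ^ 2) := by
  have hs : 0 < 1 - r ^ 2 := by linarith
  unfold besselFactor
  generalize x * z = p at hxz ⊢
  by_cases h0 : r = 0
  · subst h0
    simp only [if_true, add_tsub_cancel_right]
    simp [besselSeries_zero, Real.Gamma_nat_eq_factorial, div_eq_mul_inv]
  · simp only [if_neg h0, add_tsub_cancel_right]
    have hr0 : 0 < r ^ 2 := by positivity
    have e1 : (p / r ^ 2) ^ ((((ν + 1 : ℕ) : ℝ) - 1) / 2) =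
        Real.sqrt (p / r ^ 2) ^ ν := by
      rw [Real.sqrt_eq_rpow, ← Real.rpow_natCast _ ν, ← Real.rpow_mul (by positivity)]
      congr 1; push_cast; ring
    have e2 : (2 * Real.sqrt (p * r ^ 2) / (1 - r ^ 2)) ^ 2 / 4 =
        p * r ^ 2 / (1 - r ^ 2) ^ 2 := by
      rw [div_pow, mul_pow, Real.sq_sqrt (by positivity)]; ring
    rw [e1, besselI_eq, e2, ← mul_assoc, ← mul_pow]
    congr 2
    rw [mul_div_assoc 2, mul_div_cancel_left₀ _ (two_ne_zero), ← mul_div_assoc,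
      ← Real.sqrt_mul (by positivity),
      show p / r ^ 2 * (p * r ^ 2) = p ^ 2 by field_simp, Real.sqrt_sq hxz]

theorem image_sq_div_two_Ioi {b : ℝ} (hb : 0 ≤ b) :
    (fun t : ℝ => t ^ 2 / 2) '' Ioi b = Ioi (b ^ 2 / 2) := by
  ext v
  simp only [mem_image, mem_Ioi]
  constructor
  · rintro ⟨t, ht, rfl⟩
    nlinarith
  · intro hv
    have hv0 : 0 ≤ 2 * v := by nlinarith [sq_nonneg b]
    refine ⟨Real.sqrt (2 * v), Real.lt_sqrt_of_sq_lt (by linarith), ?_⟩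
    rw [Real.sq_sqrt hv0]; ring

/-- Substitute `v = t ^ 2 / 2`: the factor `t` is the Jacobian. The separately defined value at `a =
0` fits the same formula because the noncentral density at `l = 0` is the Gamma density. -/
theorem marcumQ_eq (ν : ℕ) (a : ℝ) {b : ℝ} (hb : 0 ≤ b) :
    marcumQ (ν + 1) a b = ∫ v in Ioi (b ^ 2 / 2), noncentralPDF ν (a ^ 2 / 2) v := by
  by_cases h0 : a = 0
  · subst h0
    simp only [marcumQ, if_true, upperGamma, add_tsub_cancel_right]
    rw [← integral_div]
    refine integral_congr_ae (ae_of_all _ fun v => ?_)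
    simp [noncentralPDF_zero, Real.Gamma_nat_eq_factorial]
  · simp only [marcumQ, if_neg h0, add_tsub_cancel_right]
    rw [← image_sq_div_two_Ioi hb, integral_image_eq_integral_abs_deriv_smul (f' := fun t => t)
      measurableSet_Ioi]
    · refine setIntegral_congr_fun measurableSet_Ioi fun t ht => ?_
      have ht0 : 0 < t := lt_of_le_of_lt hb ht
      simp only [smul_eq_mul, abs_of_pos ht0, noncentralPDF]
      rw [besselI_eq, show (a * t) ^ 2 / 4 = a ^ 2 / 2 * (t ^ 2 / 2) by ring,
        show -(t ^ 2 / 2 + a ^ 2 / 2) = -(t ^ 2 + a ^ 2) / 2 by ring,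
        show t ^ 2 / 2 = (t / a) * (a * t / 2) by field_simp, mul_pow]
      ring
    · intro t _
      simpa using ((hasDerivAt_pow 2 t).div_const 2).hasDerivWithinAt (s := Ioi b)
    · intro t ht u hu h
      have ht0 : 0 < t := lt_of_le_of_lt hb ht
      have hu0 : 0 < u := lt_of_le_of_lt hb hu
      have : t ^ 2 = u ^ 2 := by simpa using h
      exact (pow_left_inj₀ ht0.le hu0.le two_ne_zero).mp this

theorem noncentralLaw_apply (ν : ℕ) (l : ℝ) {A : Set ℝ} (hA : MeasurableSet A) :
    noncentralLaw ν l A =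
      ∫⁻ v in Ioi (0 : ℝ), A.indicator (fun v => ENNReal.ofReal (noncentralPDF ν l v)) v := by
  rw [noncentralLaw, withDensity_apply _ hA, lintegral_indicator hA]

theorem measurable_noncentralPDF_right (ν : ℕ) (l : ℝ) : Measurable (noncentralPDF ν l) :=
  (measurable_noncentralPDF ν).comp (measurable_prodMk_left (x := l))

theorem phi_eq (ν : ℕ) {r z x : ℝ} (hr : r ^ 2 < 1) (hz : 0 ≤ z) (hx : 0 ≤ x) :
    phi (ν + 1) r z x = (noncentralLaw ν (z * r ^ 2 / (1 - r ^ 2))).real (Iio (x / (1 - r ^ 2))) := by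
  have hs : 0 < 1 - r ^ 2 := by linarith
  set l := z * r ^ 2 / (1 - r ^ 2) with hl
  set y := x / (1 - r ^ 2) with hy
  have hl0 : 0 ≤ l := by positivity
  have hy0 : 0 ≤ y := by positivity
  have := isProbabilityMeasure_noncentralLaw ν hl0
  have ha : Real.sqrt (2 * z * r ^ 2 / (1 - r ^ 2)) ^ 2 / 2 = l := by
    rw [Real.sq_sqrt (by positivity), hl]; ring
  have hb : Real.sqrt (2 * x / (1 - r ^ 2)) ^ 2 / 2 = y := by
    rw [Real.sq_sqrt (by positivity), hy]; ring
  have hQ : marcumQ (ν + 1) (Real.sqrt (2 * z * r ^ 2 / (1 - r ^ 2)))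
      (Real.sqrt (2 * x / (1 - r ^ 2))) = (noncentralLaw ν l).real (Ici y) := by
    rw [marcumQ_eq ν _ (Real.sqrt_nonneg _), ha, hb, integral_eq_lintegral_of_nonneg_ae,
      measureReal_def, noncentralLaw, withDensity_apply _ measurableSet_Ici,
      Measure.restrict_restrict measurableSet_Ici]
    · congr 1
      refine setLIntegral_congr ?_
      -- The law lives on `Ioi 0`, so the tail set is `Ici y ∩ Ioi 0`: this is `Ioi 0` if `y = 0`
      -- and `Ici y` otherwise.
      refine (Ioi_ae_eq_Ici).trans ?_
      rcases hy0.eq_or_lt with h | h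
      · rw [← h, inter_eq_self_of_subset_right Ioi_subset_Ici_self]
        exact Ioi_ae_eq_Ici.symm
      · rw [inter_eq_self_of_subset_left (Ici_subset_Ioi.mpr h)]
        exact ae_eq_refl _
    · filter_upwards [ae_restrict_mem measurableSet_Ioi] with v hv
      exact (noncentralPDF_pos hl0 (lt_of_le_of_lt hy0 hv)).le
    · exact (measurable_noncentralPDF_right ν l).aestronglyMeasurable
  rw [phi, hQ, ← compl_Iio, probReal_compl_eq_one_sub measurableSet_Iio]
  ring

theorem noncentralLaw_Iio_pos (ν : ℕ) {l y : ℝ} (hl : 0 ≤ l) (hy : 0 < y) :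
    0 < noncentralLaw ν l (Iio y) := by
  rw [noncentralLaw, withDensity_apply _ measurableSet_Iio,
    Measure.restrict_restrict measurableSet_Iio, setLIntegral_pos_iff
      (measurable_noncentralPDF_right ν l).ennreal_ofReal]
  refine lt_of_lt_of_le ?_ (measure_mono (s := Ioo 0 y) fun v hv => ⟨?_, hv.2, hv.1⟩)
  · simp [hy]
  · simpa using noncentralPDF_pos hl hv.1

theorem phi_nonneg (ν : ℕ) {r z x : ℝ} (hr : r ^ 2 < 1) (hz : 0 ≤ z) (hx : 0 ≤ x) :
    0 ≤ phi (ν + 1) r z x := by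
  rw [phi_eq ν hr hz hx]; exact measureReal_nonneg

theorem phi_le_one (ν : ℕ) {r z x : ℝ} (hr : r ^ 2 < 1) (hz : 0 ≤ z) (hx : 0 ≤ x) :
    phi (ν + 1) r z x ≤ 1 := by
  have hs : 0 < 1 - r ^ 2 := by linarith
  have := isProbabilityMeasure_noncentralLaw ν (l := z * r ^ 2 / (1 - r ^ 2)) (by positivity)
  rw [phi_eq ν hr hz hx]; exact measureReal_le_one

theorem ofReal_phi (ν : ℕ) {r z x : ℝ} (hr : r ^ 2 < 1) (hz : 0 ≤ z) (hx : 0 ≤ x) :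
    ENNReal.ofReal (phi (ν + 1) r z x) =
      noncentralLaw ν (z * r ^ 2 / (1 - r ^ 2)) (Iio (x / (1 - r ^ 2))) := by
  have hs : 0 < 1 - r ^ 2 := by linarith
  have := isProbabilityMeasure_noncentralLaw ν (l := z * r ^ 2 / (1 - r ^ 2)) (by positivity)
  rw [phi_eq ν hr hz hx, ofReal_measureReal]

theorem phi_pos (ν : ℕ) {r z x : ℝ} (hr : r ^ 2 < 1) (hz : 0 ≤ z) (hx : 0 < x) :
    0 < phi (ν + 1) r z x := by
  have hs : 0 < 1 - r ^ 2 := by linarith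
  rw [← ENNReal.ofReal_pos, ofReal_phi ν hr hz hx.le]
  exact noncentralLaw_Iio_pos ν (by positivity) (by positivity)

/-- Measurability in the noncentrality and the threshold together is what the later uses of
Tonelli's theorem require. -/
theorem measurable_noncentralLaw_Iio (ν : ℕ) {α : Type*} [MeasurableSpace α] {f g : α → ℝ}
    (hf : Measurable f) (hg : Measurable g) :
    Measurable fun a => noncentralLaw ν (f a) (Iio (g a)) := by
  simp_rw [noncentralLaw_apply ν _ measurableSet_Iio]
  refine Measurable.lintegral_prod_right'
    (f := fun q : α × ℝ => (Iio (g q.1)).indicator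
      (fun v => ENNReal.ofReal (noncentralPDF ν (f q.1) v)) q.2) ?_
  have : (fun q : α × ℝ => (Iio (g q.1)).indicator
      (fun v => ENNReal.ofReal (noncentralPDF ν (f q.1) v)) q.2) =
      {q : α × ℝ | q.2 < g q.1}.indicator
        fun q => ENNReal.ofReal (noncentralPDF ν (f q.1) q.2) := by
    funext q
    simp [indicator]
  rw [this]
  refine Measurable.indicator ?_ (measurableSet_lt (by fun_prop) (by fun_prop))
  exact ((measurable_noncentralPDF ν).comp
    ((hf.comp measurable_fst).prodMk measurable_snd)).ennreal_ofReal

/-! ### Product measures: freezing a coordinate, maxima, regrouping. -/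

/-- Replacing one coordinate of a random point of a product space by an independent copy. -/
theorem map_update_prod_pi {ι : Type*} [Fintype ι] [DecidableEq ι] {α : ι → Type*}
    [∀ i, MeasurableSpace (α i)] (μ : ∀ i, Measure (α i)) [∀ i, IsProbabilityMeasure (μ i)]
    (i : ι) :
    ((μ i).prod (Measure.pi μ)).map (fun p => Function.update p.2 i p.1) = Measure.pi μ := by
  refine (Measure.pi_eq fun s hs => ?_).symm
  have hmeas : Measurable fun p : α i × (∀ j, α j) => Function.update p.2 i p.1 :=
    measurable_pi_lambda _ fun j => by
      rcases eq_or_ne j i with rfl | h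
      · simpa using measurable_fst
      · simpa [Function.update_of_ne h] using measurable_snd.eval
  rw [Measure.map_apply hmeas (.univ_pi hs)]
  have : (fun p : α i × (∀ j, α j) => Function.update p.2 i p.1) ⁻¹' univ.pi s =
      s i ×ˢ univ.pi (Function.update s i univ) := by
    ext p
    simp only [mem_preimage, Set.mem_pi, mem_univ, true_imp_iff, mem_prod]
    constructor
    · refine fun h => ⟨by simpa using h i, fun j => ?_⟩
      rcases eq_or_ne j i with rfl | hj
      · simp
      · simpa [Function.update_of_ne hj] using h j
    · rintro ⟨h0, h⟩ j
      rcases eq_or_ne j i with rfl | hj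
      · simpa using h0
      · simpa [Function.update_of_ne hj] using h j
  rw [this, Measure.prod_prod, Measure.pi_pi, ← Finset.mul_prod_erase Finset.univ _ (Finset.mem_univ i),
    ← Finset.mul_prod_erase Finset.univ (fun j => μ j (s j)) (Finset.mem_univ i)]
  simp only [Function.update_self, measure_univ, one_mul]
  congr 1
  refine Finset.prod_congr rfl fun j hj => ?_
  rw [Function.update_of_ne (Finset.ne_of_mem_erase hj)]

/-- Fubini for one coordinate without changing the index type: the overwritten coordinate stays in
the product and contributes total mass one. It serves both to condition on the reference vector and
to compute the law of a maximum. -/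
theorem pi_apply_eq_lintegral_update {ι : Type*} [Fintype ι] [DecidableEq ι] {α : ι → Type*}
    [∀ i, MeasurableSpace (α i)] (μ : ∀ i, Measure (α i)) [∀ i, IsProbabilityMeasure (μ i)]
    (i : ι) {S : Set (∀ i, α i)} (hS : MeasurableSet S) :
    Measure.pi μ S = ∫⁻ u, Measure.pi μ {w | Function.update w i u ∈ S} ∂(μ i) := by
  have hmeas : Measurable fun p : α i × (∀ j, α j) => Function.update p.2 i p.1 :=
    measurable_pi_lambda _ fun j => by
      rcases eq_or_ne j i with rfl | h
      · simpa using measurable_fst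
      · simpa [Function.update_of_ne h] using measurable_snd.eval
  conv_lhs => rw [← map_update_prod_pi μ i]
  rw [Measure.map_apply hmeas hS, Measure.prod_apply (hmeas hS)]
  rfl

/-- The probability that coordinate `i` lies in `A` and exceeds all the others. -/
theorem pi_isMax_apply {ι : Type*} [Fintype ι] [DecidableEq ι] (τ : ι → Measure ℝ)
    [∀ i, IsProbabilityMeasure (τ i)] (i : ι) {A : Set ℝ} (hA : MeasurableSet A) :
    Measure.pi τ {w | w i ∈ A ∧ ∀ k, k ≠ i → w k < w i} =
      ∫⁻ u in A, ∏ k ∈ Finset.univ.filter (fun k => k ≠ i), τ k (Iio u) ∂(τ i) := by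
  have hS : MeasurableSet {w : ι → ℝ | w i ∈ A ∧ ∀ k, k ≠ i → w k < w i} := by
    have : {w : ι → ℝ | w i ∈ A ∧ ∀ k, k ≠ i → w k < w i} =
        (fun w => w i) ⁻¹' A ∩ ⋂ k, ⋂ _ : k ≠ i, {w | w k < w i} := by
      ext w; simp
    rw [this]
    exact (measurable_pi_apply i hA).inter (MeasurableSet.iInter fun k => MeasurableSet.iInter
      fun _ => measurableSet_lt (measurable_pi_apply k) (measurable_pi_apply i))
  rw [pi_apply_eq_lintegral_update τ i hS, ← lintegral_indicator hA]
  refine lintegral_congr fun u => ?_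
  by_cases hu : u ∈ A
  · rw [indicator_of_mem hu]
    have : {w : ι → ℝ | Function.update w i u ∈ {w | w i ∈ A ∧ ∀ k, k ≠ i → w k < w i}} =
        univ.pi (Function.update (fun _ => Iio u) i univ) := by
      ext w
      simp only [mem_ofPred_eq, Function.update_self, hu, true_and, Set.mem_pi, mem_univ, true_imp_iff]
      refine forall_congr' fun k => ?_
      rcases eq_or_ne k i with rfl | hk
      · simp
      · simp [hk]
    rw [this, Measure.pi_pi, ← Finset.mul_prod_erase Finset.univ _ (Finset.mem_univ i),
      Function.update_self, measure_univ, one_mul]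
    refine Finset.prod_congr (by ext; simp) fun k hk => ?_
    rw [Function.update_of_ne (by simpa using hk)]
  · rw [indicator_of_notMem hu]
    simp [hu]

/-- Grouping a product indexed by a sum of two copies of `κ × ι` by the first coordinate. -/
theorem pi_sum_prod_map_curry {κ ι : Type*} [Fintype κ] [Fintype ι] {α : Type*}
    [MeasurableSpace α] (μ : Measure α) [IsProbabilityMeasure μ] :
    (Measure.pi fun _ : κ × ι ⊕ κ × ι => μ).map
      (fun w n => Sum.elim (fun k => w (Sum.inl (n, k))) (fun k => w (Sum.inr (n, k)))) =
    Measure.pi fun _ : κ => Measure.pi fun _ : ι ⊕ ι => μ := by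
  let e : κ × ι ⊕ κ × ι ≃ κ × (ι ⊕ ι) := (Equiv.prodSumDistrib κ ι ι).symm
  have h1 := Measure.pi_map_piCongrLeft e (fun _ : κ × (ι ⊕ ι) => μ)
  -- Currying is taken from the theory of infinite products, which agree with `Measure.pi` on finite
  -- index types.
  have h2 := Measure.infinitePi_map_curry (fun (_ : κ) (_ : ι ⊕ ι) => μ)
  simp only [Measure.infinitePi_eq_pi] at h2
  rw [← h2, ← h1, Measure.map_map (by fun_prop) (by fun_prop)]
  congr 1
  funext w n j
  rw [Function.comp_apply, MeasurableEquiv.coe_curry, Function.curry_apply,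
    MeasurableEquiv.coe_piCongrLeft]
  have : (n, j) = e (e.symm (n, j)) := by simp
  rw [this, Equiv.piCongrLeft_apply_apply]
  cases j <;> rfl

/-! ### Conditioning on the reference port. -/

noncomputable section

variable {N : ℕ} [NeZero N]

/-- The channels as functions of the real coordinates of the underlying Gaussian vectors. -/
def channelOfVectors {ι : Type*} [Fintype ι] (ρ : Fin N → ℝ) (w : Fin N → ι → ℝ) (n : Fin N) : ℝ :=
  if n = 0 then ∑ i, w 0 i ^ 2 else ∑ i, (Real.sqrt (1 - ρ n ^ 2) * w n i + ρ n * w 0 i) ^ 2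

theorem measurable_channelOfVectors {ι : Type*} [Fintype ι] (ρ : Fin N → ℝ) (n : Fin N) :
    Measurable fun w : Fin N → ι → ℝ => channelOfVectors ρ w n := by
  unfold channelOfVectors
  split_ifs <;> fun_prop

theorem channel_eq_channelOfVectors {Ω : Type*} {m : ℕ} (ρ : Fin N → ℝ)
    (x y : Fin N → Fin m → Ω → ℝ) (n : Fin N) (ω : Ω) :
    channel ρ x y n ω =
      channelOfVectors ρ (fun n => Sum.elim (fun k => x n k ω) (fun k => y n k ω)) n := by
  have hnorm : ∀ a b : ℝ, ‖(a : ℂ) + Complex.I * (b : ℂ)‖ ^ 2 = a ^ 2 + b ^ 2 := by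
    intro a b
    rw [← Complex.normSq_eq_norm_sq, mul_comm, Complex.normSq_add_mul_I]
  simp only [channel, gain, channelOfVectors]
  split_ifs with h
  · simp only [hnorm, Fintype.sum_sum_type, Sum.elim_inl, Sum.elim_inr, Finset.sum_add_distrib]
  · simp only [hnorm, Fintype.sum_sum_type, Sum.elim_inl, Sum.elim_inr, Finset.sum_add_distrib]

/-- The conditional law of the channel at port `n` given the channel `z` at the reference port. -/
def conditionalLaw (ν : ℕ) (ρ : Fin N → ℝ) (z : ℝ) (n : Fin N) : Measure ℝ :=
  if n = 0 then Measure.dirac z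
  else (noncentralLaw ν (z * ρ n ^ 2 / (1 - ρ n ^ 2))).map fun v => (1 - ρ n ^ 2) * v

theorem isProbabilityMeasure_conditionalLaw (ν : ℕ) {ρ : Fin N → ℝ}
    (hρ : ∀ n, n ≠ 0 → ρ n ^ 2 < 1) {z : ℝ} (hz : 0 ≤ z) (n : Fin N) :
    IsProbabilityMeasure (conditionalLaw ν ρ z n) := by
  unfold conditionalLaw
  split_ifs with h
  · infer_instance
  · have hs : 0 < 1 - ρ n ^ 2 := by linarith [hρ n h]
    have := isProbabilityMeasure_noncentralLaw ν (l := z * ρ n ^ 2 / (1 - ρ n ^ 2)) (by positivity)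
    exact Measure.isProbabilityMeasure_map (by fun_prop)

theorem conditionalLaw_zero (ν : ℕ) (ρ : Fin N → ℝ) (z : ℝ) :
    conditionalLaw ν ρ z 0 = Measure.dirac z := by
  simp [conditionalLaw]

theorem conditionalLaw_Iio (ν : ℕ) {ρ : Fin N → ℝ} {n : Fin N} (hn : n ≠ 0)
    (hρ : ρ n ^ 2 < 1) (z x : ℝ) :
    conditionalLaw ν ρ z n (Iio x) =
      noncentralLaw ν (z * ρ n ^ 2 / (1 - ρ n ^ 2)) (Iio (x / (1 - ρ n ^ 2))) := by
  have hs : 0 < 1 - ρ n ^ 2 := by linarith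
  rw [conditionalLaw, if_neg hn, Measure.map_apply (by fun_prop) measurableSet_Iio]
  congr 1
  ext v
  simp only [mem_preimage, mem_Iio]
  rw [lt_div_iff₀' hs]

theorem lintegral_conditionalLaw (ν : ℕ) {ρ : Fin N → ℝ} {n : Fin N} (hn : n ≠ 0)
    (hρ : ρ n ^ 2 < 1) (z : ℝ) {g : ℝ → ℝ≥0∞} (hg : Measurable g) :
    ∫⁻ x, g x ∂(conditionalLaw ν ρ z n) =
      ∫⁻ x in Ioi (0 : ℝ), ENNReal.ofReal (1 / (1 - ρ n ^ 2) *
        noncentralPDF ν (z * ρ n ^ 2 / (1 - ρ n ^ 2)) (x / (1 - ρ n ^ 2))) * g x := by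
  have hs : 0 < 1 - ρ n ^ 2 := by linarith
  generalize hsdef : 1 - ρ n ^ 2 = s at hs
  have himg : (fun v : ℝ => s * v) '' Ioi 0 = Ioi 0 := by
    rw [image_mul_left_Ioi hs, mul_zero]
  rw [conditionalLaw, if_neg hn, hsdef, lintegral_map hg (by fun_prop), noncentralLaw,
    lintegral_withDensity_eq_lintegral_mul _
      (measurable_noncentralPDF_right ν _).ennreal_ofReal (by fun_prop)]
  conv_rhs => rw [← himg]
  rw [lintegral_image_eq_lintegral_abs_deriv_mul (f' := fun _ => s) measurableSet_Ioi
    (fun v _ => by simpa using ((hasDerivAt_id v).const_mul s).hasDerivWithinAt)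
    (fun u _ v _ h => mul_left_cancel₀ hs.ne' h)]
  refine lintegral_congr fun v => ?_
  rw [Pi.mul_apply, ← mul_assoc, ← ENNReal.ofReal_mul (abs_nonneg _), abs_of_pos hs, ← mul_assoc,
    mul_one_div_cancel hs.ne', one_mul, mul_div_cancel_left₀ _ hs.ne']

/-- With the reference vector fixed, channel `n` is a function of `w n` alone, so the image of the
product measure is a product. Pulling out `1 - ρ n ^ 2` leaves a squared distance with shift `ρ n /
√(1 - ρ n ^ 2) * u i` in each coordinate, while the reference channel is constant. -/
theorem map_channelOfVectors_update {ι : Type*} [Fintype ι] {ν : ℕ}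
    (hι : Fintype.card ι = 2 * (ν + 1)) {ρ : Fin N → ℝ} (hρ : ∀ n, n ≠ 0 → ρ n ^ 2 < 1)
    (u : ι → ℝ) :
    (Measure.pi fun _ : Fin N => Measure.pi fun _ : ι => gaussianReal 0 (1 / 2)).map
      (fun w n => channelOfVectors ρ (Function.update w 0 u) n) =
    Measure.pi (conditionalLaw ν ρ (∑ i, u i ^ 2)) := by
  set γ := Measure.pi fun _ : ι => gaussianReal 0 (1 / 2)
  let f : Fin N → (ι → ℝ) → ℝ := fun n v =>
    if n = 0 then ∑ i, u i ^ 2 else ∑ i, (Real.sqrt (1 - ρ n ^ 2) * v i + ρ n * u i) ^ 2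
  have hf : ∀ n, Measurable (f n) := fun n => by
    simp only [f]; split_ifs <;> fun_prop
  have hfun : (fun (w : Fin N → ι → ℝ) n => channelOfVectors ρ (Function.update w 0 u) n) =
      fun w n => f n (w n) := by
    funext w n
    simp only [channelOfVectors, f]
    split_ifs with h
    · simp
    · simp [Function.update_of_ne h]
  have hprob : ∀ n, IsProbabilityMeasure (γ.map (f n)) := fun n =>
    Measure.isProbabilityMeasure_map (hf n).aemeasurable
  rw [hfun, Measure.pi_map_pi fun n => (hf n).aemeasurable]
  congr 1
  funext n
  by_cases h : n = 0
  · subst h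
    simp only [f, conditionalLaw_zero, if_true, Measure.map_const, measure_univ, one_smul]
  · have hs : 0 < 1 - ρ n ^ 2 := by linarith [hρ n h]
    have hs' : 0 < Real.sqrt (1 - ρ n ^ 2) := Real.sqrt_pos.mpr hs
    have hcomp : f n = (fun v => (1 - ρ n ^ 2) * v) ∘
        fun v : ι → ℝ => ∑ i, (v i + ρ n / Real.sqrt (1 - ρ n ^ 2) * u i) ^ 2 := by
      funext v
      simp only [f, if_neg h, Function.comp_apply, Finset.mul_sum]
      refine Finset.sum_congr rfl fun i _ => ?_
      nth_rewrite 2 [← Real.sq_sqrt hs.le]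
      rw [← mul_pow]
      congr 1
      field_simp
    have hl : ∑ i, (ρ n / Real.sqrt (1 - ρ n ^ 2) * u i) ^ 2 =
        (∑ i, u i ^ 2) * ρ n ^ 2 / (1 - ρ n ^ 2) := by
      simp_rw [mul_pow, div_pow, Real.sq_sqrt hs.le]
      rw [← Finset.mul_sum]; ring
    rw [hcomp, ← Measure.map_map (by fun_prop) (by fun_prop), map_sum_sq_gaussian hι, hl,
      conditionalLaw, if_neg h]

/-! ### The selection density from the conditional laws. -/

/-- The density of the channel `n` on its selection event, in terms of the noncentral laws. -/
def selectionDensity (ν : ℕ) (ρ : Fin N → ℝ) (n : Fin N) (x : ℝ) : ℝ≥0∞ :=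
  if n = 0 then ENNReal.ofReal (noncentralPDF ν 0 x) *
    ∏ k ∈ Finset.univ.filter (fun k : Fin N => k ≠ 0), conditionalLaw ν ρ x k (Iio x)
  else ∫⁻ z in Ioo 0 x, ENNReal.ofReal (noncentralPDF ν 0 z) *
    (ENNReal.ofReal (1 / (1 - ρ n ^ 2) *
        noncentralPDF ν (z * ρ n ^ 2 / (1 - ρ n ^ 2)) (x / (1 - ρ n ^ 2))) *
      ∏ k ∈ Finset.univ.filter (fun k : Fin N => k ≠ 0 ∧ k ≠ n), conditionalLaw ν ρ z k (Iio x))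

theorem measurable_conditionalLaw_Iio (ν : ℕ) {ρ : Fin N → ℝ} {n : Fin N} (hn : n ≠ 0)
    (hρ : ρ n ^ 2 < 1) {α : Type*} [MeasurableSpace α] {f g : α → ℝ} (hf : Measurable f)
    (hg : Measurable g) : Measurable fun a => conditionalLaw ν ρ (f a) n (Iio (g a)) := by
  simp_rw [conditionalLaw_Iio ν hn hρ]
  exact measurable_noncentralLaw_Iio ν ((hf.mul_const _).div_const _) (hg.div_const _)

theorem measurable_selectionKernel (ν : ℕ) {ρ : Fin N → ℝ} (hρ : ∀ n, n ≠ 0 → ρ n ^ 2 < 1)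
    (n : Fin N) : Measurable fun p : ℝ × ℝ => ENNReal.ofReal (1 / (1 - ρ n ^ 2) *
        noncentralPDF ν (p.1 * ρ n ^ 2 / (1 - ρ n ^ 2)) (p.2 / (1 - ρ n ^ 2))) *
      ∏ k ∈ Finset.univ.filter (fun k : Fin N => k ≠ 0 ∧ k ≠ n),
        conditionalLaw ν ρ p.1 k (Iio p.2) := by
  refine Measurable.mul (Measurable.ennreal_ofReal (Measurable.const_mul ?_ _)) ?_
  · exact (measurable_noncentralPDF ν).comp (by fun_prop : Measurable fun p : ℝ × ℝ =>
      (p.1 * ρ n ^ 2 / (1 - ρ n ^ 2), p.2 / (1 - ρ n ^ 2)))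
  · refine Finset.measurable_prod _ fun k hk => ?_
    have hk' : k ≠ 0 := (by simpa using hk : k ≠ 0 ∧ k ≠ n).1
    exact measurable_conditionalLaw_Iio ν hk' (hρ k hk') measurable_fst measurable_snd

theorem measurable_selectionDensity (ν : ℕ) {ρ : Fin N → ℝ} (hρ : ∀ n, n ≠ 0 → ρ n ^ 2 < 1)
    (n : Fin N) : Measurable (selectionDensity ν ρ n) := by
  unfold selectionDensity
  split_ifs with h
  · refine (measurable_noncentralPDF_right ν 0).ennreal_ofReal.mul
      (Finset.measurable_prod _ fun k hk => ?_)
    have hk' : k ≠ 0 := by simpa using hk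
    exact measurable_conditionalLaw_Iio ν hk' (hρ k hk') measurable_id measurable_id
  · simp_rw [← lintegral_indicator measurableSet_Ioo]
    refine Measurable.lintegral_prod_right' (f := fun p : ℝ × ℝ => (Ioo 0 p.1).indicator (fun z =>
      ENNReal.ofReal (noncentralPDF ν 0 z) * (ENNReal.ofReal (1 / (1 - ρ n ^ 2) *
        noncentralPDF ν (z * ρ n ^ 2 / (1 - ρ n ^ 2)) (p.1 / (1 - ρ n ^ 2))) *
      ∏ k ∈ Finset.univ.filter (fun k : Fin N => k ≠ 0 ∧ k ≠ n),
        conditionalLaw ν ρ z k (Iio p.1))) p.2) ?_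
    have hmeas := ((measurable_noncentralPDF_right ν 0).ennreal_ofReal.comp measurable_snd).mul
      ((measurable_selectionKernel ν hρ n).comp measurable_swap)
    refine (hmeas.indicator (s := {p : ℝ × ℝ | 0 < p.2 ∧ p.2 < p.1}) ?_)
    exact (measurableSet_lt measurable_const measurable_snd).inter
      (measurableSet_lt measurable_snd measurable_fst)

theorem measure_selected_channelOfVectors {ι : Type*} [Fintype ι] {ν : ℕ}
    (hι : Fintype.card ι = 2 * (ν + 1)) {ρ : Fin N → ℝ} (hρ : ∀ n, n ≠ 0 → ρ n ^ 2 < 1)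
    (n : Fin N) {A : Set ℝ} (hA : MeasurableSet A) :
    (Measure.pi fun _ : Fin N => Measure.pi fun _ : ι => gaussianReal 0 (1 / 2))
      {w | channelOfVectors ρ w n ∈ A ∧
        ∀ k, k ≠ n → channelOfVectors ρ w k < channelOfVectors ρ w n} =
    ∫⁻ x in A ∩ Ioi 0, selectionDensity ν ρ n x := by
  set γ := Measure.pi fun _ : ι => gaussianReal 0 (1 / 2)
  let S : Set (Fin N → ℝ) := {v | v n ∈ A ∧ ∀ k, k ≠ n → v k < v n}
  have hS : MeasurableSet S := by
    have : S = (fun v => v n) ⁻¹' A ∩ ⋂ k, ⋂ _ : k ≠ n, {v | v k < v n} := by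
      ext w; simp [S]
    rw [this]
    exact (measurable_pi_apply n hA).inter (MeasurableSet.iInter fun k => MeasurableSet.iInter
      fun _ => measurableSet_lt (measurable_pi_apply k) (measurable_pi_apply n))
  have hchan : Measurable fun (w : Fin N → ι → ℝ) n => channelOfVectors ρ w n :=
    measurable_pi_lambda _ fun k => measurable_channelOfVectors ρ k
  -- `H z` is the conditional probability of the event given that the reference channel equals `z ≥
  -- 0`.
  let H : ℝ → ℝ≥0∞ := fun z => if n = 0 then A.indicator (fun z =>
      ∏ k ∈ Finset.univ.filter (fun k : Fin N => k ≠ 0), conditionalLaw ν ρ z k (Iio z)) z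
    else ∫⁻ x in Ioi (0 : ℝ), (A ∩ Ioi z).indicator (fun x => ENNReal.ofReal (1 / (1 - ρ n ^ 2) *
        noncentralPDF ν (z * ρ n ^ 2 / (1 - ρ n ^ 2)) (x / (1 - ρ n ^ 2))) *
      ∏ k ∈ Finset.univ.filter (fun k : Fin N => k ≠ 0 ∧ k ≠ n), conditionalLaw ν ρ z k (Iio x)) x
  have hmeas2 : Measurable fun p : ℝ × ℝ => (A ∩ Ioi p.1).indicator (fun x =>
      ENNReal.ofReal (1 / (1 - ρ n ^ 2) *
        noncentralPDF ν (p.1 * ρ n ^ 2 / (1 - ρ n ^ 2)) (x / (1 - ρ n ^ 2))) *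
      ∏ k ∈ Finset.univ.filter (fun k : Fin N => k ≠ 0 ∧ k ≠ n),
        conditionalLaw ν ρ p.1 k (Iio x)) p.2 := by
    refine (measurable_selectionKernel ν hρ n).indicator
      (s := {p : ℝ × ℝ | p.2 ∈ A ∧ p.1 < p.2}) ?_
    exact (measurable_snd hA).inter (measurableSet_lt measurable_fst measurable_snd)
  have hH : Measurable H := by
    by_cases h : n = 0
    · simp only [H, if_pos h]
      refine Measurable.indicator (Finset.measurable_prod _ fun k hk => ?_) hA
      have hk' : k ≠ 0 := by simpa using hk
      exact measurable_conditionalLaw_Iio ν hk' (hρ k hk') measurable_id measurable_id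
    · simp only [H, if_neg h]
      exact Measurable.lintegral_prod_right' hmeas2
  have hpi : ∀ z, 0 ≤ z → Measure.pi (conditionalLaw ν ρ z) S = H z := by
    intro z hz
    have := isProbabilityMeasure_conditionalLaw ν hρ hz
    rw [pi_isMax_apply (conditionalLaw ν ρ z) n hA]
    by_cases h : n = 0
    · subst h
      simp only [H, if_true]
      rw [conditionalLaw_zero, ← lintegral_indicator hA, lintegral_dirac]
      by_cases hzA : z ∈ A
      · rw [indicator_of_mem hzA, indicator_of_mem hzA]
      · rw [indicator_of_notMem hzA, indicator_of_notMem hzA]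
    · simp only [H, if_neg h]
      -- The factor of the reference port is the Dirac mass of `Iio x`, that is, the indicator of `z
      -- < x`.
      have hprod : ∀ x, ∏ k ∈ Finset.univ.filter (fun k : Fin N => k ≠ n),
          conditionalLaw ν ρ z k (Iio x) = (Ioi z).indicator (fun x =>
            ∏ k ∈ Finset.univ.filter (fun k : Fin N => k ≠ 0 ∧ k ≠ n),
              conditionalLaw ν ρ z k (Iio x)) x := by
        intro x
        have h0 : (0 : Fin N) ∈ Finset.univ.filter (fun k : Fin N => k ≠ n) := by
          simpa using Ne.symm h
        have herase : (Finset.univ.filter (fun k : Fin N => k ≠ n)).erase 0 =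
            Finset.univ.filter (fun k : Fin N => k ≠ 0 ∧ k ≠ n) := by
          ext k; simp
        rw [← Finset.mul_prod_erase _ _ h0, herase, conditionalLaw_zero,
          Measure.dirac_apply' _ measurableSet_Iio]
        by_cases hzx : z < x
        · rw [indicator_of_mem (show z ∈ Iio x from hzx), indicator_of_mem (show x ∈ Ioi z from hzx)]
          simp
        · rw [indicator_of_notMem (show z ∉ Iio x from hzx),
            indicator_of_notMem (show x ∉ Ioi z from hzx), zero_mul]
      simp_rw [hprod]
      have hm : Measurable fun x => ∏ k ∈ Finset.univ.filter (fun k : Fin N => k ≠ 0 ∧ k ≠ n),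
          conditionalLaw ν ρ z k (Iio x) := by
        refine Finset.measurable_prod _ fun k hk => ?_
        have hk' : k ≠ 0 := (by simpa using hk : k ≠ 0 ∧ k ≠ n).1
        exact measurable_conditionalLaw_Iio ν hk' (hρ k hk') measurable_const measurable_id
      rw [← lintegral_indicator hA, lintegral_conditionalLaw ν h (hρ n h) z
        ((hm.indicator measurableSet_Ioi).indicator hA)]
      refine lintegral_congr fun x => ?_
      rw [indicator_indicator]
      by_cases hx : x ∈ A ∩ Ioi z
      · rw [indicator_of_mem hx, indicator_of_mem hx]
      · rw [indicator_of_notMem hx, indicator_of_notMem hx, mul_zero]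
  have hmap : γ.map (fun u => ∑ i, u i ^ 2) = noncentralLaw ν 0 := by
    have := map_sum_sq_gaussian hι (0 : ι → ℝ)
    simpa only [Pi.zero_apply, add_zero, zero_pow two_ne_zero, Finset.sum_const_zero] using this
  have hfirst : (Measure.pi fun _ : Fin N => γ)
      {w | channelOfVectors ρ w n ∈ A ∧
        ∀ k, k ≠ n → channelOfVectors ρ w k < channelOfVectors ρ w n} =
      ∫⁻ z in Ioi (0 : ℝ), ENNReal.ofReal (noncentralPDF ν 0 z) * H z := by
    change (Measure.pi fun _ : Fin N => γ) ((fun w n => channelOfVectors ρ w n) ⁻¹' S) = _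
    rw [pi_apply_eq_lintegral_update _ 0 (hchan hS)]
    have : ∀ u : ι → ℝ, (Measure.pi fun _ : Fin N => γ) {w | Function.update w 0 u ∈
        (fun w n => channelOfVectors ρ w n) ⁻¹' S} = H (∑ i, u i ^ 2) := by
      intro u
      rw [← hpi _ (Finset.sum_nonneg fun i _ => sq_nonneg _),
        ← map_channelOfVectors_update hι hρ u, Measure.map_apply _ hS]
      · rfl
      · exact hchan.comp (measurable_update' (a := (0 : Fin N))|>.comp
          (measurable_id.prodMk measurable_const))
    simp_rw [this]
    rw [← lintegral_map hH (by fun_prop), hmap, noncentralLaw,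
      lintegral_withDensity_eq_lintegral_mul _
        (measurable_noncentralPDF_right ν 0).ennreal_ofReal hH]
    rfl
  rw [hfirst]
  by_cases h : n = 0
  · simp only [H, selectionDensity, if_pos h]
    rw [← Measure.restrict_restrict hA, ← lintegral_indicator hA]
    refine lintegral_congr fun z => ?_
    by_cases hz : z ∈ A
    · rw [indicator_of_mem hz, indicator_of_mem hz]
    · rw [indicator_of_notMem hz, indicator_of_notMem hz, mul_zero]
  · simp only [H, selectionDensity, if_neg h]
    simp_rw [← lintegral_const_mul' _ _ ENNReal.ofReal_ne_top]
    -- After the swap, the constraint `x ∈ Ioi z` on the inner variable becomes the range `z ∈ Ioo 0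
    -- x`.
    rw [lintegral_lintegral_swap (Measurable.aemeasurable
      (((measurable_noncentralPDF_right ν 0).ennreal_ofReal.comp measurable_fst).mul hmeas2)),
      ← Measure.restrict_restrict hA, ← lintegral_indicator hA]
    refine lintegral_congr fun x => ?_
    by_cases hx : x ∈ A
    · rw [indicator_of_mem hx, ← Ioi_inter_Iio, inter_comm,
        ← Measure.restrict_restrict measurableSet_Iio, ← lintegral_indicator measurableSet_Iio]
      refine lintegral_congr fun z => ?_
      by_cases hz : z < x
      · rw [indicator_of_mem (show x ∈ A ∩ Ioi z from ⟨hx, hz⟩),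
          indicator_of_mem (show z ∈ Iio x from hz)]
      · rw [indicator_of_notMem (show x ∉ A ∩ Ioi z from fun h => hz h.2),
          indicator_of_notMem (show z ∉ Iio x from hz), mul_zero]
    · rw [indicator_of_notMem hx]
      simp [hx]

end

/-! ### Agreement with the stated formulas, positivity and measurability. -/

section

variable {N : ℕ} [NeZero N]

/-- The joint density of the reference channel and channel `n` in closed form. The exponents combine
through `z + z r ^ 2 / (1 - r ^ 2) = z / (1 - r ^ 2)`. -/
theorem noncentralPDF_mul_eq (ν : ℕ) {r z x : ℝ} (hr : r ^ 2 < 1) (hz : 0 ≤ z) (hx : 0 ≤ x) :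
    noncentralPDF ν 0 z * (1 / (1 - r ^ 2) *
      noncentralPDF ν (z * r ^ 2 / (1 - r ^ 2)) (x / (1 - r ^ 2))) =
    1 / (Real.Gamma (ν + 1 : ℕ) * (1 - r ^ 2)) *
      (Real.exp (-((x + z) / (1 - r ^ 2))) * besselFactor (ν + 1) r z x) := by
  have hs : 0 < 1 - r ^ 2 := by linarith
  rw [besselFactor_eq ν hr (mul_nonneg hx hz), noncentralPDF_zero, noncentralPDF,
    Nat.cast_add_one, Real.Gamma_nat_eq_factorial]
  have he : Real.exp (-((x + z) / (1 - r ^ 2))) = Real.exp (-z) *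
      Real.exp (-(x / (1 - r ^ 2) + z * r ^ 2 / (1 - r ^ 2))) := by
    rw [← Real.exp_add]; congr 1; field_simp; ring
  have hb : z * r ^ 2 / (1 - r ^ 2) * (x / (1 - r ^ 2)) = x * z * r ^ 2 / (1 - r ^ 2) ^ 2 := by
    field_simp
  rw [he, hb, div_pow, div_pow, mul_pow]
  field_simp

theorem besselFactor_pos (ν : ℕ) {r z x : ℝ} (hr : r ^ 2 < 1) (hz : 0 < z) (hx : 0 < x) :
    0 < besselFactor (ν + 1) r z x := by
  have hs : 0 < 1 - r ^ 2 := by linarith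
  rw [besselFactor_eq ν hr (mul_pos hx hz).le]
  have := besselSeries_pos (ν := ν) (w := x * z * r ^ 2 / (1 - r ^ 2) ^ 2) (by positivity)
  positivity

theorem integrandOther_pos (ν : ℕ) {ρ : Fin N → ℝ} (hρ : ∀ n, n ≠ 0 → ρ n ^ 2 < 1) {n : Fin N}
    (hn : n ≠ 0) {x z : ℝ} (hz : 0 < z) (hx : 0 < x) :
    0 < integrandOther (ν + 1) ρ n x z := by
  refine mul_pos (mul_pos (Real.exp_pos _) (besselFactor_pos ν (hρ n hn) hz hx))
    (Finset.prod_pos fun k hk => phi_pos ν (hρ k ?_) hz.le hx)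
  exact (by simpa using hk : k ≠ 0 ∧ k ≠ n).1

/-- The integrand is bounded on a bounded interval: the exponential and the `φ` factors are at most
`1`, and the Bessel series is dominated by the exponential series. -/
theorem integrableOn_integrandOther (ν : ℕ) {ρ : Fin N → ℝ} (hρ : ∀ n, n ≠ 0 → ρ n ^ 2 < 1)
    {n : Fin N} (hn : n ≠ 0) {x : ℝ} (hx : 0 < x) :
    IntegrableOn (integrandOther (ν + 1) ρ n x) (Ioc 0 x) := by
  have hs : 0 < 1 - ρ n ^ 2 := by linarith [hρ n hn]
  have hmeas : AEStronglyMeasurable (integrandOther (ν + 1) ρ n x) (volume.restrict (Ioc 0 x)) := by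
    -- `g` is visibly measurable on all of `ℝ` and equals the integrand on `(0, x]`, where the
    -- rewritten forms of the Bessel and `φ` factors hold.
    let g : ℝ → ℝ := fun z => Real.exp (-((x + z) / (1 - ρ n ^ 2))) *
      ((x * z / (1 - ρ n ^ 2)) ^ ν *
        besselSeries ν (x * z * ρ n ^ 2 / (1 - ρ n ^ 2) ^ 2)) *
      ∏ k ∈ Finset.univ.filter (fun k : Fin N => k ≠ 0 ∧ k ≠ n),
        (conditionalLaw ν ρ z k (Iio x)).toReal
    have hg : Measurable g := by
      refine Measurable.mul (by fun_prop) (Finset.measurable_prod _ fun k hk => ?_)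
      have hk' : k ≠ 0 := (by simpa using hk : k ≠ 0 ∧ k ≠ n).1
      exact (measurable_conditionalLaw_Iio ν hk' (hρ k hk') measurable_id
        measurable_const).ennreal_toReal
    refine hg.aestronglyMeasurable.congr ?_
    filter_upwards [ae_restrict_mem measurableSet_Ioc] with z hz
    simp only [g, integrandOther]
    rw [besselFactor_eq ν (hρ n hn) (mul_nonneg hx.le hz.1.le)]
    congr 1
    refine Finset.prod_congr rfl fun k hk => ?_
    have hk' : k ≠ 0 := (by simpa using hk : k ≠ 0 ∧ k ≠ n).1
    rw [conditionalLaw_Iio ν hk' (hρ k hk'), phi_eq ν (hρ k hk') hz.1.le hx.le, measureReal_def]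
  refine Integrable.of_bound hmeas ((x * x / (1 - ρ n ^ 2)) ^ ν *
    Real.exp (x * x * ρ n ^ 2 / (1 - ρ n ^ 2) ^ 2)) ?_
  filter_upwards [ae_restrict_mem measurableSet_Ioc] with z hz
  have hz0 : 0 < z := hz.1
  have hzx : z ≤ x := hz.2
  rw [Real.norm_of_nonneg (integrandOther_pos ν hρ hn hz0 hx).le, integrandOther]
  have h1 : Real.exp (-((x + z) / (1 - ρ n ^ 2))) ≤ 1 := by
    rw [Real.exp_le_one_iff, neg_nonpos]; positivity
  have h2 : besselFactor (ν + 1) (ρ n) z x ≤ (x * x / (1 - ρ n ^ 2)) ^ ν *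
      Real.exp (x * x * ρ n ^ 2 / (1 - ρ n ^ 2) ^ 2) := by
    rw [besselFactor_eq ν (hρ n hn) (mul_pos hx hz0).le]
    refine mul_le_mul (by gcongr) ((besselSeries_le_exp (by positivity)).trans (by gcongr))
      (besselSeries_pos (by positivity)).le (by positivity)
  have h3 : ∏ k ∈ Finset.univ.filter (fun k : Fin N => k ≠ 0 ∧ k ≠ n),
      phi (ν + 1) (ρ k) z x ≤ 1 := by
    refine Finset.prod_le_one (fun k hk => ?_) (fun k hk => ?_) <;>
    have hk' : k ≠ 0 := (by simpa using hk : k ≠ 0 ∧ k ≠ n).1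
    · exact phi_nonneg ν (hρ k hk') hz0.le hx.le
    · exact phi_le_one ν (hρ k hk') hz0.le hx.le
  have hB := (besselFactor_pos ν (hρ n hn) hz0 hx).le
  calc _ ≤ Real.exp (-((x + z) / (1 - ρ n ^ 2))) * besselFactor (ν + 1) (ρ n) z x * 1 := by
        gcongr
    _ ≤ 1 * besselFactor (ν + 1) (ρ n) z x := by
        rw [mul_one]; gcongr
    _ ≤ _ := by rwa [one_mul]

theorem density_of_nonpos (m : ℕ) (ρ : Fin N → ℝ) (n : Fin N) {x : ℝ} (hx : x ≤ 0) :
    density m ρ n x = 0 := by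
  rw [density, if_pos hx]

theorem density_pos (ν : ℕ) {ρ : Fin N → ℝ} (hρ : ∀ n, n ≠ 0 → ρ n ^ 2 < 1) (n : Fin N) {x : ℝ}
    (hx : 0 < x) : 0 < density (ν + 1) ρ n x := by
  have hΓ : 0 < Real.Gamma (ν + 1 : ℕ) := Real.Gamma_pos_of_pos (by positivity)
  rw [density, if_neg hx.not_ge]
  split_ifs with h
  · have hp : 0 < ∏ k ∈ Finset.univ.filter (fun k : Fin N => k ≠ 0), phi (ν + 1) (ρ k) x x :=
      Finset.prod_pos fun k hk => phi_pos ν (hρ k (by simpa using hk)) hx.le hx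
    unfold densityFirst
    positivity
  · have hs : 0 < 1 - ρ n ^ 2 := by linarith [hρ n h]
    have hi : 0 < ∫ z in (0 : ℝ)..x, integrandOther (ν + 1) ρ n x z :=
      intervalIntegral.intervalIntegral_pos_of_pos_on
        ((intervalIntegrable_iff_integrableOn_Ioc_of_le hx.le).mpr
          (integrableOn_integrandOther ν hρ h hx))
        (fun z hz => integrandOther_pos ν hρ h hz.1 hx) hx
    unfold densityOther
    positivity

theorem ofReal_prod_phi (ν : ℕ) {ρ : Fin N → ℝ} (hρ : ∀ n, n ≠ 0 → ρ n ^ 2 < 1) {s : Finset (Fin N)}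
    (hs : ∀ k ∈ s, k ≠ 0) {z x : ℝ} (hz : 0 ≤ z) (hx : 0 ≤ x) :
    ENNReal.ofReal (∏ k ∈ s, phi (ν + 1) (ρ k) z x) =
      ∏ k ∈ s, conditionalLaw ν ρ z k (Iio x) := by
  rw [ENNReal.ofReal_prod_of_nonneg fun k hk => phi_nonneg ν (hρ k (hs k hk)) hz hx]
  refine Finset.prod_congr rfl fun k hk => ?_
  rw [ofReal_phi ν (hρ k (hs k hk)) hz hx, conditionalLaw_Iio ν (hs k hk) (hρ k (hs k hk))]

theorem ofReal_density (ν : ℕ) {ρ : Fin N → ℝ} (hρ : ∀ n, n ≠ 0 → ρ n ^ 2 < 1) (n : Fin N) {x : ℝ}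
    (hx : 0 < x) : ENNReal.ofReal (density (ν + 1) ρ n x) = selectionDensity ν ρ n x := by
  have hΓ : 0 < Real.Gamma (ν + 1 : ℕ) := Real.Gamma_pos_of_pos (by positivity)
  rw [density, if_neg hx.not_ge, selectionDensity]
  split_ifs with h
  · have hf : densityFirst (ν + 1) ρ x = noncentralPDF ν 0 x *
        ∏ k ∈ Finset.univ.filter (fun k : Fin N => k ≠ 0), phi (ν + 1) (ρ k) x x := by
      rw [densityFirst, noncentralPDF_zero, Nat.cast_add_one, Real.Gamma_nat_eq_factorial,
        add_tsub_cancel_right]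
      ring
    rw [hf, ENNReal.ofReal_mul (noncentralPDF_pos le_rfl hx).le,
      ofReal_prod_phi ν hρ (fun k hk => by simpa using hk) hx.le hx.le]
  · have hs : 0 < 1 - ρ n ^ 2 := by linarith [hρ n h]
    have hint := (integrableOn_integrandOther ν hρ h hx).mono_set Ioo_subset_Ioc_self
    rw [densityOther, intervalIntegral.integral_of_le hx.le, integral_Ioc_eq_integral_Ioo,
      ← integral_const_mul, ofReal_integral_eq_lintegral_ofReal (hint.const_mul _)]
    · refine setLIntegral_congr_fun measurableSet_Ioo fun z hz => ?_
      have hp := noncentralPDF_pos (ν := ν) (l := z * ρ n ^ 2 / (1 - ρ n ^ 2))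
        (v := x / (1 - ρ n ^ 2)) (by have := hz.1; positivity) (by positivity)
      have hp0 := noncentralPDF_pos (ν := ν) le_rfl hz.1
      rw [← ofReal_prod_phi ν hρ (fun k hk => (by simpa using hk : k ≠ 0 ∧ k ≠ n).1) hz.1.le hx.le,
        ← mul_assoc, ← ENNReal.ofReal_mul hp0.le, ← ENNReal.ofReal_mul (by positivity),
        noncentralPDF_mul_eq ν (hρ n h) hz.1.le hx.le, integrandOther]
      congr 1
      ring
    · filter_upwards [ae_restrict_mem measurableSet_Ioo] with z hz
      have := integrandOther_pos ν hρ h hz.1 hx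
      simp only [Pi.zero_apply]
      positivity

theorem ofReal_density_eq_indicator (ν : ℕ) {ρ : Fin N → ℝ} (hρ : ∀ n, n ≠ 0 → ρ n ^ 2 < 1)
    (n : Fin N) : (fun x => ENNReal.ofReal (density (ν + 1) ρ n x)) =
      (Ioi 0).indicator (selectionDensity ν ρ n) := by
  funext x
  by_cases hx : 0 < x
  · rw [indicator_of_mem (show x ∈ Ioi 0 from hx), ofReal_density ν hρ n hx]
  · rw [indicator_of_notMem (show x ∉ Ioi 0 from hx), density_of_nonpos _ _ _ (not_lt.mp hx),
      ENNReal.ofReal_zero]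

theorem density_nonneg (ν : ℕ) {ρ : Fin N → ℝ} (hρ : ∀ n, n ≠ 0 → ρ n ^ 2 < 1) (n : Fin N)
    (x : ℝ) : 0 ≤ density (ν + 1) ρ n x := by
  rcases le_or_gt x 0 with hx | hx
  · rw [density_of_nonpos _ _ _ hx]
  · exact (density_pos ν hρ n hx).le

/-- A nonnegative function is recovered from its `ENNReal.ofReal`, here the indicator of the
measurable `selectionDensity`. -/
theorem measurable_density (ν : ℕ) {ρ : Fin N → ℝ} (hρ : ∀ n, n ≠ 0 → ρ n ^ 2 < 1) (n : Fin N) :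
    Measurable (density (ν + 1) ρ n) := by
  have h : Measurable fun x => ENNReal.ofReal (density (ν + 1) ρ n x) := by
    rw [ofReal_density_eq_indicator ν hρ n]
    exact (measurable_selectionDensity ν hρ n).indicator measurableSet_Ioi
  convert h.ennreal_toReal using 2 with x
  rw [ENNReal.toReal_ofReal (density_nonneg ν hρ n x)]

end

/-! ### Transfer to the given probability space and conclusion. -/

/-- The Gaussian vectors behind the ports are independent and standard. -/
theorem hasLaw_vectors_pi {Ω : Type*} [MeasurableSpace Ω] {P : Measure Ω} [IsProbabilityMeasure P]
    {N m : ℕ} {x y : Fin N → Fin m → Ω → ℝ}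
    (hx : ∀ n k, HasLaw (x n k) (gaussianReal 0 (1 / 2)) P)
    (hy : ∀ n k, HasLaw (y n k) (gaussianReal 0 (1 / 2)) P)
    (hindep : iIndepFun
      (Sum.elim (fun p : Fin N × Fin m => x p.1 p.2) (fun p : Fin N × Fin m => y p.1 p.2)) P) :
    HasLaw (fun ω n => Sum.elim (fun k => x n k ω) (fun k => y n k ω))
      (Measure.pi fun _ : Fin N => Measure.pi fun _ : Fin m ⊕ Fin m => gaussianReal 0 (1 / 2)) P := by
  have hlaw : ∀ i, HasLaw (Sum.elim (fun p : Fin N × Fin m => x p.1 p.2)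
      (fun p : Fin N × Fin m => y p.1 p.2) i) (gaussianReal 0 (1 / 2)) P := by
    rintro (p | p)
    · exact hx _ _
    · exact hy _ _
  have hmap := (iIndepFun_iff_map_fun_eq_pi_map fun i => (hlaw i).aemeasurable).mp hindep
  simp_rw [(hlaw _).map_eq] at hmap
  have hflat : HasLaw (fun ω i => Sum.elim (fun p : Fin N × Fin m => x p.1 p.2)
      (fun p : Fin N × Fin m => y p.1 p.2) i ω) (Measure.pi fun _ => gaussianReal 0 (1 / 2)) P :=
    ⟨aemeasurable_pi_lambda _ fun i => (hlaw i).aemeasurable, hmap⟩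
  have hcurry : Measurable fun (w : Fin N × Fin m ⊕ Fin N × Fin m → ℝ) (n : Fin N) =>
      (Sum.elim (fun k => w (Sum.inl (n, k))) (fun k => w (Sum.inr (n, k))) :
        Fin m ⊕ Fin m → ℝ) := by
    refine measurable_pi_lambda _ fun n => measurable_pi_lambda _ fun i => ?_
    rcases i with k | k <;> simp only [Sum.elim_inl, Sum.elim_inr] <;> fun_prop
  exact (HasLaw.mk hcurry.aemeasurable (pi_sum_prod_map_curry _)).comp hflat

theorem aemeasurable_channel {Ω : Type*} [MeasurableSpace Ω] {P : Measure Ω}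
    {N : ℕ} [NeZero N] {m : ℕ} (ρ : Fin N → ℝ) {x y : Fin N → Fin m → Ω → ℝ}
    (hw : AEMeasurable (fun ω n => (Sum.elim (fun k => x n k ω) (fun k => y n k ω) :
      Fin m ⊕ Fin m → ℝ)) P) (n : Fin N) : AEMeasurable (channel ρ x y n) P := by
  have hchan : channel ρ x y n = (fun w => channelOfVectors ρ w n) ∘
      fun ω n => Sum.elim (fun k => x n k ω) (fun k => y n k ω) :=
    funext fun ω => channel_eq_channelOfVectors ρ x y n ω
  rw [hchan]
  exact (measurable_channelOfVectors ρ n).comp_aemeasurable hw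

theorem map_channel_restrict_selected {Ω : Type*} [MeasurableSpace Ω] {P : Measure Ω}
    [IsProbabilityMeasure P] {N : ℕ} [NeZero N] {ν : ℕ} {ρ : Fin N → ℝ}
    (hρ : ∀ n, n ≠ 0 → ρ n ^ 2 < 1) {x y : Fin N → Fin (ν + 1) → Ω → ℝ}
    (hx : ∀ n k, HasLaw (x n k) (gaussianReal 0 (1 / 2)) P)
    (hy : ∀ n k, HasLaw (y n k) (gaussianReal 0 (1 / 2)) P)
    (hindep : iIndepFun (Sum.elim (fun p : Fin N × Fin (ν + 1) => x p.1 p.2)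
      (fun p : Fin N × Fin (ν + 1) => y p.1 p.2)) P) (n : Fin N) :
    (P.restrict (selected ρ x y n)).map (channel ρ x y n) =
      volume.withDensity (fun t => ENNReal.ofReal (density (ν + 1) ρ n t)) := by
  have hlaw := hasLaw_vectors_pi hx hy hindep
  have hae := aemeasurable_channel ρ hlaw.aemeasurable
  -- The coordinates are only a.e. measurable, so the selection event is only null-measurable.
  have hsel : NullMeasurableSet (selected ρ x y n) P := by
    have : selected ρ x y n = ⋂ k, ⋂ _ : k ≠ n, {ω | channel ρ x y k ω < channel ρ x y n ω} := by
      ext ω; simp [selected]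
    rw [this]
    exact .iInter fun k => .iInter fun _ => nullMeasurableSet_lt (hae k) (hae n)
  ext A hA
  have hS : MeasurableSet {w : Fin N → Fin (ν + 1) ⊕ Fin (ν + 1) → ℝ |
      channelOfVectors ρ w n ∈ A ∧
        ∀ k, k ≠ n → channelOfVectors ρ w k < channelOfVectors ρ w n} := by
    have : {w : Fin N → Fin (ν + 1) ⊕ Fin (ν + 1) → ℝ | channelOfVectors ρ w n ∈ A ∧
        ∀ k, k ≠ n → channelOfVectors ρ w k < channelOfVectors ρ w n} =
        (fun w => channelOfVectors ρ w n) ⁻¹' A ∩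
          ⋂ k, ⋂ _ : k ≠ n, {w | channelOfVectors ρ w k < channelOfVectors ρ w n} := by
      ext w; simp
    rw [this]
    exact (measurable_channelOfVectors ρ n hA).inter (.iInter fun k => .iInter fun _ =>
      measurableSet_lt (measurable_channelOfVectors ρ k) (measurable_channelOfVectors ρ n))
  rw [Measure.map_apply_of_aemeasurable (hae n).restrict hA, Measure.restrict_apply₀' hsel,
    withDensity_apply _ hA, ofReal_density_eq_indicator ν hρ n,
    setLIntegral_indicator measurableSet_Ioi, inter_comm (Ioi 0),
    ← measure_selected_channelOfVectors (ι := Fin (ν + 1) ⊕ Fin (ν + 1))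
      (by simp; ring) hρ n hA, ← hlaw.measure_eq hS]
  congr 1
  ext ω
  simp only [selected, mem_inter_iff, mem_preimage, mem_ofPred_eq, channel_eq_channelOfVectors]

end FluidAntenna

theorem proposition2 {Ω : Type*} [MeasurableSpace Ω] (P : Measure Ω) [IsProbabilityMeasure P]
    (N : ℕ) [NeZero N] (m : ℕ) (hm : 1 ≤ m)
    (ρ : Fin N → ℝ) (hρ : ∀ n, n ≠ 0 → |ρ n| < 1)
    (x y : Fin N → Fin m → Ω → ℝ)
    (hx : ∀ n k, HasLaw (x n k) (gaussianReal 0 (1 / 2)) P)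
    (hy : ∀ n k, HasLaw (y n k) (gaussianReal 0 (1 / 2)) P)
    (hindep : iIndepFun
      (Sum.elim (fun p : Fin N × Fin m => x p.1 p.2) (fun p : Fin N × Fin m => y p.1 p.2)) P)
    (n : Fin N) :
    -- the expression is a genuine integrable nonnegative function
    (n ≠ 0 → ∀ t : ℝ, 0 < t → IntervalIntegrable (integrandOther m ρ n t) volume 0 t) ∧
    (∀ t, 0 ≤ density m ρ n t) ∧
    Integrable (density m ρ n) ∧
    -- it is the density of the channel at port `n` on the event that port `n` is selected
    (P.restrict (selected ρ x y n)).map (channel ρ x y n) =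
      volume.withDensity (fun t => ENNReal.ofReal (density m ρ n t)) ∧
    -- its total mass is the (positive) selection probability
    0 < P.real (selected ρ x y n) ∧
    P.real (selected ρ x y n) = ∫ t, density m ρ n t ∧
    -- divided by it, it is the density under the conditional probability measure
    (ProbabilityTheory.cond P (selected ρ x y n)).map (channel ρ x y n) =
      volume.withDensity (fun t => ENNReal.ofReal
        (density m ρ n t / P.real (selected ρ x y n))) := by
  obtain ⟨ν, rfl⟩ : ∃ ν, m = ν + 1 := ⟨m - 1, by omega⟩
  have hρ' : ∀ n, n ≠ 0 → ρ n ^ 2 < 1 := fun n hn => (sq_lt_one_iff_abs_lt_one _).mpr (hρ n hn)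
  have hmap := map_channel_restrict_selected hρ' hx hy hindep n
  have hnonneg := density_nonneg ν hρ' n
  have hae := aemeasurable_channel ρ (hasLaw_vectors_pi hx hy hindep).aemeasurable n
  -- Comparing total masses in `hmap` gives the selection probability; its finiteness then yields
  -- integrability.
  have hmass : ∫⁻ t, ENNReal.ofReal (density (ν + 1) ρ n t) = P (selected ρ x y n) := by
    have := congrArg (fun μ => μ Set.univ) hmap
    simp only [Measure.map_apply_of_aemeasurable hae.restrict MeasurableSet.univ, Set.preimage_univ,
      Measure.restrict_apply MeasurableSet.univ, Set.univ_inter, withDensity_apply _ MeasurableSet.univ,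
      Measure.restrict_univ] at this
    exact this.symm
  have hint : Integrable (density (ν + 1) ρ n) := by
    rw [← lintegral_ofReal_ne_top_iff_integrable
      (measurable_density ν hρ' n).aestronglyMeasurable (ae_of_all _ hnonneg), hmass]
    exact measure_ne_top _ _
  have hreal : P.real (selected ρ x y n) = ∫ t, density (ν + 1) ρ n t := by
    rw [integral_eq_lintegral_of_nonneg_ae (ae_of_all _ hnonneg) hint.aestronglyMeasurable, hmass,
      measureReal_def]
  have hpos : 0 < P.real (selected ρ x y n) := by
    -- The density is strictly positive on all of `Ioi 0`, so its support has positive measure.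
    rw [hreal, integral_pos_iff_support_of_nonneg hnonneg hint]
    refine lt_of_lt_of_le ?_ (measure_mono (s := Set.Ioi 0) fun t ht => (density_pos ν hρ' n ht).ne')
    simp
  refine ⟨fun hn t ht => ?_, hnonneg, hint, hmap, hpos, hreal, ?_⟩
  · exact (intervalIntegrable_iff_integrableOn_Ioc_of_le ht.le).mpr
      (integrableOn_integrandOther ν hρ' hn ht)
  -- The conditional measure is the restriction scaled by the inverse probability, so the density is
  -- scaled alike.
  · rw [ProbabilityTheory.cond, Measure.map_smul, hmap, ← withDensity_smul _
      (measurable_density ν hρ' n).ennreal_ofReal]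
    congr 1
    funext t
    rw [Pi.smul_apply, smul_eq_mul, ENNReal.ofReal_div_of_pos hpos, ofReal_measureReal,
      ENNReal.div_eq_inv_mul]
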